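/- For an integer $n\ge 0$ let $K_n$ be the complete graph on $n$ vertices. For a finite graph $G=(V,E)$, let its flow polynomial $F_G$ be the characteristic polynomial of the dual of the graphic matroid of $G$, that is, $F_G(x)=\sum_{A\subseteq E}(-1)^{|A|}x^{r^*(E)-r^*(A)}$, where $r^*(A)=r(E\setminus A)+|A|-r(E)$, $r(A)=|V|-c(A)$, and $c(A)$ is the number of connected components of the graph $(V,A)$. For real $x$ put $$S_n(z)=\sum_{i=0}^{n}\frac{z^i}{i!}(1-x)^{i(i-1)/2}.$$ Then for every $n\ge 0$ and every real $x\neq 0$ the function $z\mapsto S_n(z)^x$ (a real power of a function that is positive near $z=0$) is $n$ times continuously differentiable at $z=0$, and $$F_{K_n}(x)=\frac{(-1)^{n(n-1)/2}}{x^n}\left.\frac{\partial^n}{\partial z^n}\Bigl[S_n(z)^x\Bigr]\right|_{z=0}.$$ -/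

import Mathlib

open Polynomial

/-- A matroid on the finite ground set `E`, given by its rank function. -/
structure RankMatroid (E : Type*) [Fintype E] [DecidableEq E] where
  /-- the rank function -/
  r : Finset E → ℕ
  r_le_card : ∀ A, r A ≤ A.card
  r_mono : ∀ A B, A ⊆ B → r A ≤ r B
  r_submod : ∀ A B, r (A ∪ B) + r (A ∩ B) ≤ r A + r B

namespace RankMatroid

variable {E : Type*} [Fintype E] [DecidableEq E]

theorem r_univ_le (M : RankMatroid E) (A : Finset E) :
    M.r Finset.univ ≤ M.r Aᶜ + A.card := by
  have h := M.r_submod Aᶜ A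
  have h' := M.r_le_card A
  rw [Finset.union_comm, Finset.union_compl] at h
  omega

theorem r_union_le (M : RankMatroid E) (A B : Finset E) :
    M.r (A ∪ B) ≤ M.r A + B.card := by
  have h := M.r_submod A B
  have h' := M.r_le_card B
  omega

/-- The dual matroid, `r*(A) = r(E - A) + |A| - r(E)`. The subtraction of natural numbers
does not truncate, by `r_univ_le`. -/
def dual (M : RankMatroid E) : RankMatroid E where
  r A := M.r Aᶜ + A.card - M.r Finset.univ
  r_le_card A := by
    have := M.r_mono Aᶜ Finset.univ (Finset.subset_univ _)
    omega
  r_mono A B h := by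
    have h1 : Aᶜ ⊆ Bᶜ ∪ (B \ A) := by
      intro e he
      by_cases hB : e ∈ B <;> simp_all
    have h2 := (M.r_mono _ _ h1).trans (M.r_union_le _ _)
    have h3 := Finset.card_sdiff_add_card_eq_card h
    omega
  r_submod A B := by
    have h1 := M.r_submod Aᶜ Bᶜ
    have h2 := Finset.card_union_add_card_inter A B
    have hA := M.r_univ_le A
    have hB := M.r_univ_le B
    have hI := M.r_univ_le (A ∩ B)
    have hU := M.r_univ_le (A ∪ B)
    rw [← Finset.compl_inter, ← Finset.compl_union] at h1
    omega

/-- The characteristic polynomial `χ_M(x) = ∑_{A ⊆ E} (-1)^|A| x^(r(E) - r(A))`. -/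
noncomputable def charPoly (M : RankMatroid E) : ℤ[X] :=
  ∑ A : Finset E, (-1) ^ A.card * X ^ (M.r Finset.univ - M.r A)

end RankMatroid

namespace SimpleGraph

variable {V : Type*}

/-- The spanning subgraph `(V, A)` of `G` with edge set `A`. -/
def edgeSubgraph (G : SimpleGraph V) (A : Finset G.edgeSet) : SimpleGraph V :=
  SimpleGraph.fromEdgeSet (Subtype.val '' (A : Set G.edgeSet))

/-- The number of connected components of the spanning subgraph `(V, A)`. -/
noncomputable def numComponents (G : SimpleGraph V) (A : Finset G.edgeSet) : ℕ :=
  Nat.card (G.edgeSubgraph A).ConnectedComponent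

/-- The real functions on the vertices which are constant along every edge of `A`. -/
def edgeConst (G : SimpleGraph V) (A : Finset G.edgeSet) : Submodule ℝ (V → ℝ) where
  carrier := {f | ∀ u v, (G.edgeSubgraph A).Adj u v → f u = f v}
  add_mem' {f g} hf hg u v h := by simp [hf u v h, hg u v h]
  zero_mem' u v _ := rfl
  smul_mem' c f hf u v h := by simp [hf u v h]

theorem mem_edgeConst (G : SimpleGraph V) (A : Finset G.edgeSet) (f : V → ℝ) :
    f ∈ G.edgeConst A ↔ ∀ u v, (G.edgeSubgraph A).Adj u v → f u = f v := Iff.rfl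

theorem edgeSubgraph_adj (G : SimpleGraph V) (A : Finset G.edgeSet) (u v : V) :
    (G.edgeSubgraph A).Adj u v ↔ ∃ h : s(u, v) ∈ G.edgeSet, ⟨s(u, v), h⟩ ∈ A := by
  simp only [edgeSubgraph, fromEdgeSet_adj, Set.mem_image, Finset.mem_coe, Subtype.exists,
    exists_and_right, exists_eq_right]
  constructor
  · exact fun h => h.1
  · rintro ⟨h, hA⟩
    exact ⟨⟨h, hA⟩, G.ne_of_adj h⟩

theorem edgeConst_anti (G : SimpleGraph V) {A B : Finset G.edgeSet} (h : A ⊆ B) :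
    G.edgeConst B ≤ G.edgeConst A := by
  intro f hf u v huv
  obtain ⟨h1, h2⟩ := (G.edgeSubgraph_adj A u v).1 huv
  exact hf u v ((G.edgeSubgraph_adj B u v).2 ⟨h1, h h2⟩)

variable [Fintype V]

theorem numComponents_eq_finrank (G : SimpleGraph V) (A : Finset G.edgeSet) :
    G.numComponents A = Module.finrank ℝ (G.edgeConst A) := by
  classical
  have h : G.edgeConst A = LinearMap.ker (Matrix.toLin' ((G.edgeSubgraph A).lapMatrix ℝ)) := by
    ext f
    rw [LinearMap.mem_ker, Matrix.toLin'_apply, lapMatrix_mulVec_eq_zero_iff_forall_adj]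
    rfl
  rw [h, ← card_connectedComponent_eq_finrank_ker_toLin'_lapMatrix, numComponents,
    Nat.card_eq_fintype_card]

theorem numComponents_le (G : SimpleGraph V) (A : Finset G.edgeSet) :
    G.numComponents A ≤ Fintype.card V := by
  rw [numComponents_eq_finrank]
  simpa using (G.edgeConst A).finrank_le

theorem numComponents_anti (G : SimpleGraph V) {A B : Finset G.edgeSet} (h : A ⊆ B) :
    G.numComponents B ≤ G.numComponents A := by
  simp only [numComponents_eq_finrank]
  exact Submodule.finrank_mono (G.edgeConst_anti h)

theorem card_le_numComponents_singleton (G : SimpleGraph V) (e : G.edgeSet) :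
    Fintype.card V ≤ G.numComponents {e} + 1 := by
  rw [numComponents_eq_finrank]
  obtain ⟨e, he⟩ := e
  induction e with | _ a b =>
  let φ : (V → ℝ) →ₗ[ℝ] ℝ :=
    LinearMap.proj (R := ℝ) (φ := fun _ : V => ℝ) a - LinearMap.proj b
  have h1 : LinearMap.ker φ ≤ G.edgeConst {⟨s(a, b), he⟩} := by
    intro f hf u v huv
    have hf' : f a = f b := by simpa [φ, sub_eq_zero] using hf
    obtain ⟨h, h'⟩ := (G.edgeSubgraph_adj _ u v).1 huv
    simp only [Finset.mem_singleton, Subtype.mk.injEq, Sym2.eq_iff] at h'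
    rcases h' with ⟨rfl, rfl⟩ | ⟨rfl, rfl⟩
    · exact hf'
    · exact hf'.symm
  have h2 := Submodule.finrank_mono h1
  have h3 := φ.finrank_range_add_finrank_ker
  have h4 := (LinearMap.range φ).finrank_le
  simp only [Module.finrank_fintype_fun_eq_card, Module.finrank_self] at h3 h4
  omega

variable [DecidableEq V]

theorem numComponents_supermod (G : SimpleGraph V) (A B : Finset G.edgeSet) :
    G.numComponents A + G.numComponents B ≤
      G.numComponents (A ∪ B) + G.numComponents (A ∩ B) := by
  simp only [numComponents_eq_finrank]
  have h1 : G.edgeConst (A ∪ B) = G.edgeConst A ⊓ G.edgeConst B := by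
    apply le_antisymm
    · exact le_inf (G.edgeConst_anti Finset.subset_union_left)
        (G.edgeConst_anti Finset.subset_union_right)
    · rintro f ⟨hA, hB⟩ u v huv
      obtain ⟨h, h'⟩ := (G.edgeSubgraph_adj _ u v).1 huv
      rcases Finset.mem_union.1 h' with h' | h'
      · exact hA u v ((G.edgeSubgraph_adj _ u v).2 ⟨h, h'⟩)
      · exact hB u v ((G.edgeSubgraph_adj _ u v).2 ⟨h, h'⟩)
  have h2 : G.edgeConst A ⊔ G.edgeConst B ≤ G.edgeConst (A ∩ B) :=
    sup_le (G.edgeConst_anti Finset.inter_subset_left)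
      (G.edgeConst_anti Finset.inter_subset_right)
  have h3 := Submodule.finrank_mono h2
  have h4 := Submodule.finrank_sup_add_finrank_inf_eq (G.edgeConst A) (G.edgeConst B)
  rw [h1]
  omega

theorem card_le_numComponents_add_card (G : SimpleGraph V) (A : Finset G.edgeSet) :
    Fintype.card V ≤ G.numComponents A + A.card := by
  induction A using Finset.induction_on with
  | empty =>
    rw [numComponents_eq_finrank]
    have : G.edgeConst ∅ = ⊤ := by
      rw [eq_top_iff]
      intro f _ u v huv
      obtain ⟨_, h⟩ := (G.edgeSubgraph_adj _ u v).1 huv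
      simp at h
    rw [this, finrank_top]
    simp
  | insert e A he ih =>
    have h1 := G.numComponents_supermod {e} A
    have h2 := G.card_le_numComponents_singleton e
    have h3 := G.numComponents_le ({e} ∩ A)
    rw [← Finset.insert_eq] at h1
    rw [Finset.card_insert_of_notMem he]
    omega

/-- The graphic matroid of `G`, on the edges of `G`: the rank of a set `A` of edges is the
number of vertices minus the number of connected components of the graph formed by `A`.
(Vertices that are not incident with `A` may be counted or not: each contributes one vertex
and one component.) -/
noncomputable def graphicMatroid (G : SimpleGraph V) [DecidableRel G.Adj] :
    RankMatroid G.edgeSet where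
  r A := Fintype.card V - G.numComponents A
  r_le_card A := by
    have := G.card_le_numComponents_add_card A
    omega
  r_mono A B h := by
    have := G.numComponents_anti h
    omega
  r_submod A B := by
    have h := G.numComponents_supermod A B
    have hA := G.numComponents_le A
    have hB := G.numComponents_le B
    have hI := G.numComponents_le (A ∩ B)
    have hU := G.numComponents_le (A ∪ B)
    omega

/-- The flow polynomial: the characteristic polynomial of the dual of the graphic matroid. -/
noncomputable def flowPolynomial (G : SimpleGraph V) [DecidableRel G.Adj] : ℤ[X] :=
  G.graphicMatroid.dual.charPoly

end SimpleGraph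

/-
By duality, `x ^ |V| * F_G(x)` is, up to sign, the Fortuin-Kasteleyn polynomial
`∑ A, w ^ |A| * y ^ c(A)` at weight `w = -x` and `y = x`. At `y = k` colours this polynomial sums
`(1 + w) ^ (number of monochromatic edges)` over all `k`-colourings of the vertices. For `K_n` the
summand is the product of `(1 + w) ^ (m choose 2)` over the sizes `m` of the colour classes, that
is, of the `m`-th derivatives of `S_n` at `0`, so the generalized Leibniz rule identifies the sum
with the `n`-th derivative of `S_n ^ k` at `0`. The `n`-th derivative of `S_n ^ y` at `0` is
polynomial in `y`, hence agreement at all natural `y` is agreement at all real `y`.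
-/

section Leibniz

variable {𝕜 𝔸 κ : Type*} [NontriviallyNormedField 𝕜] [NormedCommRing 𝔸] [NormedAlgebra 𝕜 𝔸]
  [Fintype κ] [DecidableEq κ]

theorem differentiableAt_iteratedDeriv {E : Type*} [NormedAddCommGroup E] [NormedSpace 𝕜 E]
    {f : 𝕜 → E} {t : 𝕜} {m n : ℕ} (hf : ContDiffAt 𝕜 n f t) (hmn : m < n) :
    DifferentiableAt 𝕜 (iteratedDeriv m f) t := by
  simpa only [← iteratedDerivWithin_univ, differentiableWithinAt_univ] using
    hf.contDiffWithinAt.differentiableWithinAt_iteratedDerivWithin (s := Set.univ)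
      (by exact_mod_cast hmn)
      (by simpa only [Set.insert_eq_of_mem, Set.mem_univ] using uniqueDiffOn_univ)

theorem deriv_prod_iteratedDeriv {F : κ → 𝕜 → 𝔸} {t : 𝕜} {n : ℕ} {m : κ → ℕ}
    (hF : ∀ c, ContDiffAt 𝕜 n (F c) t) (hm : ∀ c, m c < n) :
    deriv (fun z => ∏ c, iteratedDeriv (m c) (F c) z) t =
      ∑ d, ∏ c, iteratedDeriv ((if d = c then 1 else 0) + m c) (F c) t := by
  rw [deriv_fun_finsetProd fun c _ => differentiableAt_iteratedDeriv (hF c) (hm c)]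
  refine Finset.sum_congr rfl fun d _ => ?_
  rw [← Finset.prod_erase_mul _ _ (Finset.mem_univ d), if_pos rfl, add_comm 1, iteratedDeriv_succ,
    smul_eq_mul]
  congr 1
  refine Finset.prod_congr rfl fun c hc => ?_
  rw [if_neg (Finset.ne_of_mem_erase hc).symm, zero_add]

theorem iteratedDeriv_fun_finsetProd_univ {F : κ → 𝕜 → 𝔸} {t : 𝕜} {n : ℕ}
    (hF : ∀ c, ContDiffAt 𝕜 n (F c) t) :
    iteratedDeriv n (fun z => ∏ c, F c z) t =
      ∑ f : Fin n → κ, ∏ c, iteratedDeriv (Finset.card {i | f i = c}) (F c) t := by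
  induction n generalizing t with
  | zero => simp
  | succ n ih =>
    have hlt (f : Fin n → κ) (c : κ) : Finset.card {i | f i = c} < n + 1 :=
      Nat.lt_succ_of_le (card_finset_fin_le _)
    have hev : iteratedDeriv n (fun z => ∏ c, F c z) =ᶠ[nhds t] fun z =>
        ∑ f : Fin n → κ, ∏ c, iteratedDeriv (Finset.card {i | f i = c}) (F c) z := by
      have hnear : ∀ᶠ z in nhds t, ∀ c, ContDiffAt 𝕜 (n + 1 : ℕ) (F c) z :=
        Filter.eventually_all.2 fun c => (hF c).eventually (by simp)
      filter_upwards [hnear] with z hz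
      exact ih fun c => (hz c).of_le (by exact_mod_cast n.le_succ)
    have hdiff (f : Fin n → κ) : DifferentiableAt 𝕜
        (fun z => ∏ c, iteratedDeriv (Finset.card {i | f i = c}) (F c) z) t :=
      DifferentiableAt.fun_finsetProd fun c _ => differentiableAt_iteratedDeriv (hF c) (hlt f c)
    rw [iteratedDeriv_succ, hev.deriv_eq, deriv_fun_sum fun f _ => hdiff f,
      ← (Fin.consEquiv fun _ => κ).sum_comp, Fintype.sum_prod_type_right]
    refine Finset.sum_congr rfl fun f _ => ?_
    rw [deriv_prod_iteratedDeriv hF (hlt f)]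
    simp only [Fin.consEquiv_apply, Fin.card_filter_univ_succ', Fin.cons_zero, Fin.cons_succ]

end Leibniz

theorem iteratedDeriv_sum_pow_div_factorial_mul {𝕜 : Type*} [NontriviallyNormedField 𝕜]
    [CharZero 𝕜] (a : ℕ → 𝕜) {m N : ℕ} (hm : m < N) :
    iteratedDeriv m (fun z => ∑ i ∈ Finset.range N, z ^ i / (i.factorial : 𝕜) * a i) 0 = a m := by
  have hterm (i : ℕ) :
      iteratedDeriv m (fun z => z ^ i / (i.factorial : 𝕜) * a i) 0 = if m = i then a i else 0 := by
    have hfac : (i.factorial : 𝕜) ≠ 0 := Nat.cast_ne_zero.2 i.factorial_ne_zero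
    simp only [div_mul_comm _ _ (a i)]
    rw [iteratedDeriv_const_mul_field, iteratedDeriv_fun_pow_zero]
    split_ifs
    · exact div_mul_cancel₀ _ hfac
    · rw [Nat.cast_zero, mul_zero]
  rw [iteratedDeriv_fun_sum fun i _ => by fun_prop]
  simp only [hterm]
  rw [Finset.sum_ite_eq, if_pos (Finset.mem_range.2 hm)]

theorem deriv_rpow_const_mul {S g : ℝ → ℝ} {z : ℝ} (hS : DifferentiableAt ℝ S z)
    (hg : DifferentiableAt ℝ g z) (h0 : S z ≠ 0) (y : ℝ) :
    deriv (fun z => S z ^ y * g z) z =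
      y * (S z ^ y * (deriv S z * g z / S z)) + S z ^ y * deriv g z := by
  rw [deriv_fun_mul (hS.rpow_const (Or.inl h0)) hg, deriv_rpow_const hS (Or.inl h0),
    Real.rpow_sub_one h0]
  ring

theorem exists_iteratedDeriv_rpow_mul_eq_eval {S : ℝ → ℝ} {t : ℝ} (h0 : S t ≠ 0) {n : ℕ}
    (hS : ContDiffAt ℝ n S t) {g : ℝ → ℝ} (hg : ContDiffAt ℝ n g t) :
    ∃ P : ℝ[X], ∀ y : ℝ, iteratedDeriv n (fun z => S z ^ y * g z) t = S t ^ y * P.eval y := by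
  induction n generalizing g with
  | zero => exact ⟨C (g t), fun y => by simp⟩
  | succ n ih =>
    have hSn : ContDiffAt ℝ n S t := hS.of_le (by exact_mod_cast n.le_succ)
    have hgn : ContDiffAt ℝ n g t := hg.of_le (by exact_mod_cast n.le_succ)
    have hg' : ContDiffAt ℝ n (deriv g) t := hg.derivWithin (by norm_cast)
    have hq : ContDiffAt ℝ n (fun z => deriv S z * g z / S z) t :=
      ((hS.derivWithin (by norm_cast)).mul hgn).div hSn h0
    obtain ⟨P, hP⟩ := ih hSn hq
    obtain ⟨Q, hQ⟩ := ih hSn hg'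
    refine ⟨X * P + Q, fun y => ?_⟩
    have hderiv : deriv (fun z => S z ^ y * g z) =ᶠ[nhds t] fun z =>
        y * (S z ^ y * (deriv S z * g z / S z)) + S z ^ y * deriv g z := by
      filter_upwards [hS.continuousAt.eventually_ne h0,
        hS.eventually (by simp),
        hg.eventually (by simp)] with z hz hSz hgz
      exact deriv_rpow_const_mul (hSz.differentiableAt (by simp)) (hgz.differentiableAt (by simp))
        hz y
    have hpow : ContDiffAt ℝ n (fun z => S z ^ y) t := hSn.rpow_const_of_ne h0
    rw [iteratedDeriv_succ', hderiv.iteratedDeriv_eq,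
      iteratedDeriv_fun_add (contDiffAt_const.mul (hpow.mul hq)) (hpow.mul hg'),
      iteratedDeriv_const_mul_field, hP, hQ, eval_add, eval_mul, eval_X]
    ring

theorem exists_iteratedDeriv_rpow_eq_eval {S : ℝ → ℝ} {t : ℝ} (h1 : S t = 1) {n : ℕ}
    (hS : ContDiffAt ℝ n S t) :
    ∃ P : ℝ[X], ∀ y : ℝ, iteratedDeriv n (fun z => S z ^ y) t = P.eval y := by
  simpa only [mul_one, h1, Real.one_rpow, one_mul] using
    exists_iteratedDeriv_rpow_mul_eq_eval (h1 ▸ one_ne_zero) hS (contDiffAt_const (c := (1 : ℝ)))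

theorem RankMatroid.charPoly_dual {E : Type*} [Fintype E] [DecidableEq E] (M : RankMatroid E) :
    M.dual.charPoly = ∑ A : Finset E, (-1) ^ Aᶜ.card * X ^ (A.card - M.r A) := by
  rw [charPoly, ← Equiv.sum_comp (Function.Involutive.toPerm _ compl_involutive)]
  refine Finset.sum_congr rfl fun A _ => ?_
  have hempty : M.r ∅ = 0 := Nat.le_zero.1 (M.r_le_card ∅)
  have hexp : M.dual.r Finset.univ - M.dual.r Aᶜ = A.card - M.r A := by
    have hdual := M.r_univ_le Aᶜ
    have hrank := M.r_le_card A
    have hspan := M.r_univ_le Finset.univ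
    have hcard := Finset.card_add_card_compl A
    simp only [dual, Finset.compl_univ, compl_compl, hempty, Finset.card_univ] at *
    omega
  simp only [Function.Involutive.coe_toPerm, hexp]

section Graph

variable {V : Type*}

theorem card_forall_adj_eq [Finite V] (G : SimpleGraph V) (κ : Type*) :
    Nat.card {f : V → κ // ∀ u v, G.Adj u v → f u = f v} =
      Nat.card κ ^ Nat.card G.ConnectedComponent := by
  have hlift (f : {f : V → κ // ∀ u v, G.Adj u v → f u = f v}) (u v : V) (p : G.Walk u v) :
      f.1 u = f.1 v := by
    induction p with
    | nil => rfl
    | cons huv _ ih => exact (f.2 _ _ huv).trans ih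
  let e : {f : V → κ // ∀ u v, G.Adj u v → f u = f v} ≃ (G.ConnectedComponent → κ) :=
    { toFun := fun f => SimpleGraph.ConnectedComponent.lift f.1 fun u v p _ => hlift f u v p
      invFun := fun φ => ⟨fun v => φ (G.connectedComponentMk v), fun _ _ huv =>
        congrArg φ (SimpleGraph.ConnectedComponent.connectedComponentMk_eq_of_adj huv)⟩
      left_inv := fun _ => rfl
      right_inv := fun φ => by
        ext c
        induction c using SimpleGraph.ConnectedComponent.ind
        rfl }
  rw [Nat.card_congr e, Nat.card_fun]

variable {κ R : Type*} [DecidableEq κ] (G : SimpleGraph V)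

/-- The edges of `G` whose two ends have the same colour under `f`. -/
def monochromaticEdges [Fintype G.edgeSet] (f : V → κ) : Finset G.edgeSet :=
  {e | (e.1.map f).IsDiag}

theorem subset_monochromaticEdges_iff [Fintype G.edgeSet] (f : V → κ) (A : Finset G.edgeSet) :
    A ⊆ monochromaticEdges G f ↔ ∀ u v, (G.edgeSubgraph A).Adj u v → f u = f v := by
  have hmem (u v : V) (h : s(u, v) ∈ G.edgeSet) :
      ⟨s(u, v), h⟩ ∈ monochromaticEdges G f ↔ f u = f v := by
    simp [monochromaticEdges]
  constructor
  · intro hA u v huv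
    obtain ⟨h, huvA⟩ := (G.edgeSubgraph_adj A u v).1 huv
    exact (hmem u v h).1 (hA huvA)
  · rintro hf ⟨e, he⟩ heA
    induction e with
    | _ u v => exact (hmem u v he).2 (hf u v ((G.edgeSubgraph_adj A u v).2 ⟨he, heA⟩))

theorem card_monochromaticEdges_completeGraph [Fintype V] [DecidableEq V] [Fintype κ]
    (f : V → κ) :
    (monochromaticEdges (SimpleGraph.completeGraph V) f).card =
      ∑ c, (Finset.card {v | f v = c}).choose 2 := by
  let pairs (c : κ) : Finset (Sym2 V) :=
    (Finset.offDiag {v | f v = c}).image Sym2.mk.uncurry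
  have hpairs (c : κ) (u v : V) : s(u, v) ∈ pairs c ↔ u ≠ v ∧ f u = c ∧ f v = c := by
    simp only [pairs, Finset.mem_image, Finset.mem_offDiag, Finset.mem_filter, Finset.mem_univ,
      true_and, Prod.exists, Function.uncurry_apply_pair, Sym2.eq_iff]
    aesop
  have hunion : (monochromaticEdges (SimpleGraph.completeGraph V) f).map
      (Function.Embedding.subtype _) = Finset.univ.biUnion pairs := by
    ext e
    induction e with
    | _ u v => simp [monochromaticEdges, hpairs, eq_comm, and_comm]
  have hdisj : Set.PairwiseDisjoint (Finset.univ : Finset κ) pairs := by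
    refine fun c _ d _ hcd => Finset.disjoint_left.2 fun e hc hd => hcd ?_
    induction e with
    | _ u v => exact ((hpairs c u v).1 hc).2.1.symm.trans ((hpairs d u v).1 hd).2.1
  rw [← Finset.card_map, hunion, Finset.card_biUnion hdisj]
  simp only [pairs, Sym2.card_image_offDiag]

/-- The Fortuin-Kasteleyn polynomial of `G` with edge weight `w`: the partition function of the
random cluster model, as a polynomial in the number of colours. -/
noncomputable def fkPolynomial [Fintype G.edgeSet] [CommSemiring R] (w : R) : R[X] :=
  ∑ A : Finset G.edgeSet, C (w ^ A.card) * X ^ G.numComponents A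

theorem eval_fkPolynomial [Fintype G.edgeSet] [CommSemiring R] (w y : R) :
    (fkPolynomial G w).eval y = ∑ A : Finset G.edgeSet, w ^ A.card * y ^ G.numComponents A := by
  simp only [fkPolynomial, eval_finsetSum, eval_mul, eval_C, eval_pow, eval_X]

theorem eval_card_fkPolynomial [Fintype V] [DecidableEq V] [Fintype G.edgeSet] [Fintype κ]
    [CommSemiring R] (w : R) :
    (fkPolynomial G w).eval (Fintype.card κ : R) =
      ∑ f : V → κ, (w + 1) ^ (monochromaticEdges G f).card := by
  classical
  have hcount (A : Finset G.edgeSet) :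
      Fintype.card κ ^ G.numComponents A =
        Finset.card {f : V → κ | A ⊆ monochromaticEdges G f} := by
    simp only [subset_monochromaticEdges_iff]
    rw [← Fintype.card_subtype, ← Nat.card_eq_fintype_card, ← Nat.card_eq_fintype_card,
      card_forall_adj_eq, SimpleGraph.numComponents]
  calc
    (fkPolynomial G w).eval (Fintype.card κ : R)
      = ∑ A : Finset G.edgeSet, ∑ f : V → κ,
          if A ⊆ monochromaticEdges G f then w ^ A.card else 0 := by
        rw [eval_fkPolynomial]
        refine Finset.sum_congr rfl fun A _ => ?_
        rw [← Nat.cast_pow, hcount, ← Finset.sum_filter, Finset.sum_const, nsmul_eq_mul, mul_comm]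
    _ = ∑ f : V → κ, ∑ A ∈ (monochromaticEdges G f).powerset, w ^ A.card := by
        rw [Finset.sum_comm]
        simp only [← Finset.sum_filter, ← Finset.mem_powerset, Finset.filter_univ_mem]
    _ = ∑ f : V → κ, (w + 1) ^ (monochromaticEdges G f).card := by
        refine Finset.sum_congr rfl fun f _ => ?_
        simpa only [one_pow, mul_one] using
          Finset.sum_pow_mul_eq_add_pow w 1 (monochromaticEdges G f)

theorem pow_card_mul_aeval_flowPolynomial [Fintype V] [DecidableEq V] [DecidableRel G.Adj]
    [CommRing R] (x : R) :
    x ^ Fintype.card V * aeval x G.flowPolynomial =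
      (-1) ^ Fintype.card G.edgeSet * (fkPolynomial G (-x)).eval x := by
  rw [SimpleGraph.flowPolynomial, RankMatroid.charPoly_dual, map_sum, eval_fkPolynomial,
    Finset.mul_sum, Finset.mul_sum]
  refine Finset.sum_congr rfl fun A _ => ?_
  have hexp : Fintype.card V + (A.card - G.graphicMatroid.r A) = A.card + G.numComponents A := by
    have hrank : G.graphicMatroid.r A = Fintype.card V - G.numComponents A := rfl
    have hle := G.numComponents_le A
    have hcard := G.card_le_numComponents_add_card A
    omega
  have hsign : (-1 : R) ^ Aᶜ.card = (-1) ^ Fintype.card G.edgeSet * (-1) ^ A.card := by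
    rw [← Finset.card_compl_add_card A, pow_add, mul_assoc, ← mul_pow, neg_one_mul, neg_neg,
      one_pow, mul_one]
  simp only [map_mul, map_pow, map_neg, map_one, aeval_X]
  rw [mul_left_comm, ← pow_add, hexp, pow_add, hsign, neg_pow x]
  ring

end Graph

theorem eval_fkPolynomial_completeGraph {n : ℕ} {w : ℝ} {S : ℝ → ℝ} (hS : ContDiffAt ℝ n S 0)
    (hderiv : ∀ m ≤ n, iteratedDeriv m S 0 = (w + 1) ^ m.choose 2) (y : ℝ) :
    (fkPolynomial (SimpleGraph.completeGraph (Fin n)) w).eval y =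
      iteratedDeriv n (fun z => S z ^ y) 0 := by
  have hone : S 0 = 1 := by simpa using hderiv 0 n.zero_le
  obtain ⟨P, hP⟩ := exists_iteratedDeriv_rpow_eq_eval hone hS
  have hnat (k : ℕ) :
      (fkPolynomial (SimpleGraph.completeGraph (Fin n)) w).eval (k : ℝ) = P.eval (k : ℝ) := by
    calc
      _ = ∑ f : Fin n → Fin k, ∏ c, (w + 1) ^ (Finset.card {i | f i = c}).choose 2 := by
          simpa only [Fintype.card_fin, card_monochromaticEdges_completeGraph,
            Finset.prod_pow_eq_pow_sum] using eval_card_fkPolynomial (κ := Fin k)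
              (SimpleGraph.completeGraph (Fin n)) w
      _ = ∑ f : Fin n → Fin k, ∏ c : Fin k, iteratedDeriv (Finset.card {i | f i = c}) S 0 := by
          simp only [hderiv _ (card_finset_fin_le _)]
      _ = iteratedDeriv n (fun z => S z ^ (k : ℝ)) 0 := by
          rw [← iteratedDeriv_fun_finsetProd_univ fun _ => hS]
          simp only [Finset.prod_const, Finset.card_univ, Fintype.card_fin, Real.rpow_natCast]
      _ = P.eval (k : ℝ) := hP k
  have hnatCast : (Set.range ((↑) : ℕ → ℝ)).Infinite :=
    Set.infinite_range_of_injective Nat.cast_injective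
  rw [hP, eq_of_infinite_eval_eq _ P (hnatCast.mono (Set.range_subset_iff.2 hnat))]

theorem corollary4 (n : ℕ) (x : ℝ) (hx : x ≠ 0) :
    ContDiffAt ℝ n (fun z : ℝ =>
      (∑ i ∈ Finset.range (n + 1),
        z ^ i / (i.factorial : ℝ) * (1 - x) ^ (i * (i - 1) / 2)) ^ x) 0 ∧
    Polynomial.aeval x (SimpleGraph.completeGraph (Fin n)).flowPolynomial =
      (-1) ^ (n * (n - 1) / 2) / x ^ n *
        iteratedDeriv n (fun z : ℝ =>
          (∑ i ∈ Finset.range (n + 1),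
            z ^ i / (i.factorial : ℝ) * (1 - x) ^ (i * (i - 1) / 2)) ^ x) 0 := by
  simp only [← Nat.choose_two_right]
  set S : ℝ → ℝ := fun z =>
    ∑ i ∈ Finset.range (n + 1), z ^ i / (i.factorial : ℝ) * (1 - x) ^ i.choose 2
  have hS : ContDiffAt ℝ n S 0 := by fun_prop
  have hderiv (m : ℕ) (hm : m ≤ n) : iteratedDeriv m S 0 = (-x + 1) ^ m.choose 2 := by
    rw [neg_add_eq_sub]
    exact iteratedDeriv_sum_pow_div_factorial_mul _ (Nat.lt_succ_of_le hm)
  have hone : S 0 = 1 := by simpa using hderiv 0 n.zero_le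
  refine ⟨hS.rpow_const_of_ne (hone ▸ one_ne_zero), ?_⟩
  have hcard : Fintype.card (SimpleGraph.completeGraph (Fin n)).edgeSet = n.choose 2 := by
    rw [← SimpleGraph.edgeFinset_card]
    simpa using SimpleGraph.card_edgeFinset_top_eq_card_choose_two (V := Fin n)
  have hflow := pow_card_mul_aeval_flowPolynomial (SimpleGraph.completeGraph (Fin n)) x
  rw [Fintype.card_fin, hcard, eval_fkPolynomial_completeGraph hS hderiv] at hflow
  rw [div_mul_eq_mul_div, eq_div_iff (pow_ne_zero n hx), mul_comm, hflow]
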